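/- A single user has age of information $x\in\{1,2,\dots\}$ and, in every slot, a channel state $q\in\{1,\dots,Q\}$; the channel states are i.i.d. over the slots with probabilities $\eta_1,\dots,\eta_Q$. In every slot the user is either scheduled ($s=1$) or idle ($s=0$); the next age is $1$ if $s=1$ and $x+1$ if $s=0$. Fix real numbers $\omega(1)<\dots<\omega(Q)$ (power consumption), $W\ge 0$ (scheduling penalty), $\lambda\ge 0$ (power multiplier) and $\mathcal E$ (power budget). Consider the problem of minimizing $$\lim_{T\to\infty}\frac1T\,\mathbb E_\pi\Big[\sum_{t=1}^{T}\big(x(t)+W s(t)+\lambda\,\omega(q(t))\,s(t)\big)\Big]-\lambda\mathcal E$$ over all non-anticipative (history-dependent, possibly randomized) policies $\pi$. Call a policy optimal (for a given initial age) if for it this limit exists and is finite and does not exceed the limit inferior, as $T\to\infty$, of the same expression for any non-anticipative policy. Then: (a) There are a stationary deterministic policy $s^*(x,q)\in\{0,1\}$, optimal for every initial age $x(1)\ge 1$, and thresholds $\tau_1,\dots,\tau_Q\in\mathbb N$ such that $s^*(x,q)=1$ if $x\ge\tau_q$ and $s^*(x,q)=0$ if $x<\tau_q$, for all $x$ and $q$,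 and $\tau_1\le\tau_2\le\dots\le\tau_Q$. (b) For every stationary deterministic policy $a$ that is optimal for the initial age $x(1)=1$ there are thresholds $\tau_1,\dots,\tau_Q\in\mathbb N$ such that, in every state $(x,q)$ that is visited with positive probability under $a$ from $x(1)=1$, $a(x,q)=1$ exactly when $x\ge\tau_q$; if $\lambda>0$, they can be chosen with $\tau_1\le\tau_2\le\dots\le\tau_Q$. -/

import Mathlib

open Filter Topology

noncomputable section

namespace AoI

/-- State of the user at the beginning of a slot: the age of information and the channel state.
The channel states `1, …, Q` are represented by `Fin Q`. -/
abbrev State (Q : ℕ) : Type := ℕ × Fin Q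

/-- The past of a slot: the states and decisions (`true` means "schedule") of all earlier slots,
the most recent slot first. -/
abbrev History (Q : ℕ) : Type := List (State Q × Bool)

/-- A non-anticipative (history dependent, possibly randomized) policy: the law of the decision
in the current slot, given the complete past and the current state. -/
abbrev Policy (Q : ℕ) : Type := History Q → State Q → PMF Bool

/-- The stationary deterministic policy that takes the decision `a x q` in state `(x, q)`. -/
def stationary {Q : ℕ} (a : ℕ → Fin Q → Bool) : Policy Q :=
  fun _ s => PMF.pure (a s.1 s.2)

/-- The age drops to `1` after a scheduled slot and grows by one after an idle slot. -/
def nextAge (x : ℕ) (u : Bool) : ℕ := if u then 1 else x + 1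

/-- Joint law of the past and the current state after `t` slots, for initial age `x₀` and i.i.d.
channel states with law `η`. -/
def law {Q : ℕ} (η : PMF (Fin Q)) (x₀ : ℕ) (π : Policy Q) : ℕ → PMF (History Q × State Q)
  | 0 => η.map fun q => ([], (x₀, q))
  | t + 1 => (law η x₀ π t).bind fun p => (π p.1 p.2).bind fun u =>
      η.map fun q => ((p.2, u) :: p.1, (nextAge p.2.1 u, q))

/-- One-step cost of age and scheduling: `x + W s`. -/
def costX {Q : ℕ} (W : ℝ) (s : State Q) (u : Bool) : ℝ := s.1 + W * (if u then 1 else 0)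

/-- One-step power consumption: `ω(q) s`. -/
def costQ {Q : ℕ} (ω : Fin Q → ℝ) (s : State Q) (u : Bool) : ℝ := ω s.2 * (if u then 1 else 0)

/-- Total cost, with power multiplier `lam`, of the slots recorded in a history. -/
def totalCost {Q : ℕ} (ω : Fin Q → ℝ) (W lam : ℝ) (h : History Q) : ℝ :=
  (h.map fun e => costX W e.1 e.2 + lam * costQ ω e.1 e.2).sum

/-- Expected average cost over the first `T` slots, minus the constant `lam * E` of the
Lagrangian. The law has finite support, so the sum is a finite one. -/
def avgCost {Q : ℕ} (η : PMF (Fin Q)) (ω : Fin Q → ℝ) (W lam E : ℝ) (x₀ : ℕ) (π : Policy Q)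
    (T : ℕ) : ℝ :=
  (1 / (T : ℝ)) * (∑' p : History Q × State Q, (law η x₀ π T p).toReal * totalCost ω W lam p.1)
    - lam * E

/-- `π` minimizes the long-run expected average cost over all non-anticipative policies: its
long-run average exists, and no policy does better, not even along a subsequence of horizons. -/
def IsOptimal {Q : ℕ} (η : PMF (Fin Q)) (ω : Fin Q → ℝ) (W lam E : ℝ) (x₀ : ℕ)
    (π : Policy Q) : Prop :=
  ∃ g : ℝ, Tendsto (avgCost η ω W lam E x₀ π) atTop (𝓝 g) ∧
    ∀ π' : Policy Q,
      (g : EReal) ≤ liminf (fun T : ℕ => ((avgCost η ω W lam E x₀ π' T : ℝ) : EReal)) atTop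

/-- The state `s` is visited with positive probability in some slot. -/
def Visits {Q : ℕ} (η : PMF (Fin Q)) (x₀ : ℕ) (π : Policy Q) (s : State Q) : Prop :=
  ∃ (t : ℕ) (h : History Q), law η x₀ π t (h, s) ≠ 0

end AoI

end

/-! Put `c q = W + lam * ω q`. Because channel states are i.i.d., the optimality equation involves
the age alone: `g + V x = x + E min (c q, V (x + 1))` with `V 1 = 0`. `exists_relativeValue` solves
it with `V` growing by at least one per step. Scheduling when `c q ≤ V (x + 1)` is then a threshold
rule in the age, and its thresholds increase with `q` because `c` does.

Optimality is a potential argument: telescoping a one-step inequality (`le_expect_total`) bounds the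
average cost up to `O(1/T)`. Since `V` is unbounded, the lower bound for arbitrary policies uses `V`
truncated above `max c`, which does not alter the minimum; the upper bound for the greedy rule only
needs `V` bounded below.

For part (b), suppose a stationary policy decides suboptimally in a visited state of age `y`. Its
one-step inequality has positive slack at `y`, and truncation gives slack at large ages. A small
multiple of the bounded function from `exists_drift` spreads this slack over all ages, so the
average cost is at least `g + ε - lam * E`. Hence an optimal policy can deviate from the greedy rule
on visited states only at ties, at most one age per channel state. -/

noncomputable section

namespace AoI

/-! ### Expectations under finitely supported laws. -/

/-- Expectation of a real function under a probability mass function. -/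
def expect {α : Type*} (p : PMF α) (f : α → ℝ) : ℝ := ∑' a, (p a).toReal * f a

section Expect

variable {α β : Type*}

theorem expect_eq_sum (p : PMF α) (f : α → ℝ) {S : Finset α} (hS : p.support ⊆ S) :
    expect p f = ∑ a ∈ S, (p a).toReal * f a := by
  refine tsum_eq_sum fun a ha => ?_
  have h0 : p a = 0 := by
    by_contra h
    exact ha (hS ((p.mem_support_iff a).2 h))
  simp [h0]

theorem expect_fintype [Fintype α] (p : PMF α) (f : α → ℝ) :
    expect p f = ∑ a, (p a).toReal * f a := tsum_fintype _

theorem expect_pure (a : α) (f : α → ℝ) : expect (PMF.pure a) f = f a := by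
  rw [expect_eq_sum (S := {a}) _ _ (by simp)]
  simp

theorem expect_bind {p : PMF α} {k : α → PMF β} (hp : p.support.Finite)
    (hk : ∀ a, (k a).support.Finite) (f : β → ℝ) :
    expect (p.bind k) f = expect p fun a => expect (k a) f := by
  classical
  set S := hp.toFinset with hS
  set R : Finset β := S.biUnion fun a => (hk a).toFinset with hR
  have hsub : ∀ a ∈ S, (k a).support ⊆ R := fun a ha b hb => by
    rw [hR, Finset.mem_coe, Finset.mem_biUnion]
    exact ⟨a, ha, by simpa using hb⟩
  have hb : (p.bind k).support ⊆ R := by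
    intro b hb
    obtain ⟨a, ha, hab⟩ := (PMF.mem_support_bind_iff p k b).1 hb
    exact hsub a (by simpa [hS] using ha) hab
  have hpS : p.support ⊆ S := by simp [hS]
  rw [expect_eq_sum _ _ hb, expect_eq_sum _ _ hpS]
  have key : ∀ b, ((p.bind k) b).toReal = ∑ a ∈ S, (p a).toReal * (k a b).toReal := by
    intro b
    rw [PMF.bind_apply, tsum_eq_sum (s := S), ENNReal.toReal_sum]
    · simp
    · exact fun a _ => ENNReal.mul_ne_top (p.apply_ne_top a) ((k a).apply_ne_top b)
    · intro a ha
      have : p a = 0 := by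
        by_contra h
        exact ha (hpS ((p.mem_support_iff a).2 h))
      simp [this]
  simp_rw [key, Finset.sum_mul]
  rw [Finset.sum_comm]
  refine Finset.sum_congr rfl fun a ha => ?_
  rw [expect_eq_sum _ _ (hsub a ha), Finset.mul_sum]
  exact Finset.sum_congr rfl fun b _ => by ring

theorem finite_support_bind {p : PMF α} {k : α → PMF β} (hp : p.support.Finite)
    (hk : ∀ a, (k a).support.Finite) : (p.bind k).support.Finite := by
  rw [PMF.support_bind]
  exact hp.biUnion fun a _ => hk a

theorem finite_support_map {p : PMF α} (hp : p.support.Finite) (g : α → β) :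
    (p.map g).support.Finite := by
  rw [PMF.support_map]
  exact hp.image g

theorem expect_map {p : PMF α} (hp : p.support.Finite) (g : α → β) (f : β → ℝ) :
    expect (p.map g) f = expect p fun a => f (g a) := by
  have h : p.map g = p.bind fun a => PMF.pure (g a) := rfl
  rw [h, expect_bind hp (fun a => by simp)]
  simp_rw [expect_pure]

theorem expect_mono {p : PMF α} (hp : p.support.Finite) {f g : α → ℝ}
    (h : ∀ a, p a ≠ 0 → f a ≤ g a) : expect p f ≤ expect p g := by
  have hS : p.support ⊆ hp.toFinset := by simp
  rw [expect_eq_sum _ _ hS, expect_eq_sum _ _ hS]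
  refine Finset.sum_le_sum fun a ha => mul_le_mul_of_nonneg_left (h a ?_) ENNReal.toReal_nonneg
  simpa using ha

theorem expect_add {p : PMF α} (hp : p.support.Finite) (f g : α → ℝ) :
    expect p (fun a => f a + g a) = expect p f + expect p g := by
  have hS : p.support ⊆ hp.toFinset := by simp
  simp_rw [expect_eq_sum _ _ hS, mul_add, Finset.sum_add_distrib]

theorem expect_mul_left (p : PMF α) (c : ℝ) (f : α → ℝ) :
    expect p (fun a => c * f a) = c * expect p f := by
  unfold expect
  rw [← tsum_mul_left]
  exact tsum_congr fun a => by ring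

theorem expect_neg (p : PMF α) (f : α → ℝ) :
    expect p (fun a => - f a) = - expect p f := by
  simpa using expect_mul_left p (-1) f

theorem expect_const (p : PMF α) (c : ℝ) : expect p (fun _ => c) = c := by
  unfold expect
  rw [tsum_mul_right, ← ENNReal.tsum_toReal_eq p.apply_ne_top, p.tsum_coe]
  simp

theorem expect_const_add {p : PMF α} (hp : p.support.Finite) (c : ℝ) (f : α → ℝ) :
    expect p (fun a => c + f a) = c + expect p f := by
  rw [expect_add hp, expect_const]

end Expect

/-! ### The law of the controlled process and telescoping of potentials. -/

section Law

variable {Q : ℕ} {η : PMF (Fin Q)} {x₀ : ℕ} {π : Policy Q}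

theorem finite_support_law (t : ℕ) : (law η x₀ π t).support.Finite := by
  induction t with
  | zero => exact finite_support_map (Set.toFinite _) _
  | succ t ih =>
    exact finite_support_bind ih fun p => finite_support_bind (Set.toFinite _) fun u =>
      finite_support_map (Set.toFinite _) _

theorem expect_law_zero (F : History Q × State Q → ℝ) :
    expect (law η x₀ π 0) F = expect η fun q => F ([], (x₀, q)) :=
  expect_map (Set.toFinite _) _ _

theorem expect_law_succ (t : ℕ) (F : History Q × State Q → ℝ) :
    expect (law η x₀ π (t + 1)) F = expect (law η x₀ π t) fun p =>
      expect (π p.1 p.2) fun u => expect η fun q => F ((p.2, u) :: p.1, (nextAge p.2.1 u, q)) := by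
  have e : law η x₀ π (t + 1) = (law η x₀ π t).bind fun p => (π p.1 p.2).bind fun u =>
      η.map fun q => ((p.2, u) :: p.1, (nextAge p.2.1 u, q)) := rfl
  rw [e, expect_bind (finite_support_law t) fun p => finite_support_bind (Set.toFinite _) fun u =>
      finite_support_map (Set.toFinite _) _]
  congr 1
  ext p
  rw [expect_bind (Set.toFinite _) fun u => finite_support_map (Set.toFinite _) _]
  congr 1
  ext u
  exact expect_map (Set.toFinite _) _ _

theorem law_succ_ne_zero {t : ℕ} {p' : History Q × State Q} (hp : law η x₀ π (t + 1) p' ≠ 0) :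
    ∃ p u q, law η x₀ π t p ≠ 0 ∧ π p.1 p.2 u ≠ 0 ∧ η q ≠ 0 ∧
      p' = ((p.2, u) :: p.1, (nextAge p.2.1 u, q)) := by
  have e : law η x₀ π (t + 1) = (law η x₀ π t).bind fun p => (π p.1 p.2).bind fun u =>
      η.map fun q => ((p.2, u) :: p.1, (nextAge p.2.1 u, q)) := rfl
  rw [← PMF.mem_support_iff, e, PMF.mem_support_bind_iff] at hp
  obtain ⟨p, h1, h2⟩ := hp
  obtain ⟨u, h3, h4⟩ := (PMF.mem_support_bind_iff _ _ _).1 h2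
  obtain ⟨q, h5, h6⟩ := (PMF.mem_support_map_iff _ _ _).1 h4
  exact ⟨p, u, q, h1, h3, h5, h6.symm⟩

theorem law_zero_ne_zero {p' : History Q × State Q} (hp : law η x₀ π 0 p' ≠ 0) :
    ∃ q, η q ≠ 0 ∧ p' = ([], (x₀, q)) := by
  have e : law η x₀ π 0 = η.map fun q => ([], (x₀, q)) := rfl
  rw [← PMF.mem_support_iff, e] at hp
  obtain ⟨q, h5, h6⟩ := (PMF.mem_support_map_iff _ _ _).1 hp
  exact ⟨q, h5, h6.symm⟩

theorem nextAge_true (x : ℕ) : nextAge x true = 1 := rfl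

theorem nextAge_false (x : ℕ) : nextAge x false = x + 1 := rfl

theorem one_le_age (hx : 1 ≤ x₀) {t : ℕ} {p : History Q × State Q} (hp : law η x₀ π t p ≠ 0) :
    1 ≤ p.2.1 := by
  cases t with
  | zero => obtain ⟨q, -, rfl⟩ := law_zero_ne_zero hp; exact hx
  | succ t =>
    obtain ⟨p, u, q, -, -, -, rfl⟩ := law_succ_ne_zero hp
    cases u <;> simp [nextAge]

/-- A potential `h` on the states with one-step drift at least `G - k` bounds the expected total
cost from below. -/
theorem le_expect_total (k : State Q → Bool → ℝ) (h : State Q → ℝ) (G : ℝ) (hx : 1 ≤ x₀)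
    (hk : ∀ l s u, 1 ≤ s.1 → π l s u ≠ 0 →
      G + h s ≤ k s u + expect η fun q => h (nextAge s.1 u, q)) (T : ℕ) :
    T * G + expect η (fun q => h (x₀, q)) ≤
      expect (law η x₀ π T) fun p => (p.1.map fun e => k e.1 e.2).sum + h p.2 := by
  induction T with
  | zero => simp [expect_law_zero]
  | succ T ih =>
    rw [expect_law_succ]
    have step : G + expect (law η x₀ π T) (fun p => (p.1.map fun e => k e.1 e.2).sum + h p.2) ≤
        expect (law η x₀ π T) fun p => expect (π p.1 p.2) fun u => expect η fun q =>
          (List.map (fun e => k e.1 e.2) ((p.2, u) :: p.1)).sum + h (nextAge p.2.1 u, q) := by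
      rw [← expect_const_add (finite_support_law T)]
      refine expect_mono (finite_support_law T) fun p hp => ?_
      rw [← expect_const (π p.1 p.2) (G + _)]
      refine expect_mono (Set.toFinite _) fun u hu => ?_
      rw [expect_const_add (Set.toFinite _), List.map_cons, List.sum_cons]
      have := hk p.1 p.2 u (one_le_age hx hp) hu
      linarith
    push_cast
    linarith

end Law

/-! ### Average cost bounds from potentials. -/

section Average

variable {Q : ℕ} {η : PMF (Fin Q)} {ω : Fin Q → ℝ} {W lam E : ℝ} {x₀ : ℕ} {π : Policy Q}

theorem avgCost_eq (T : ℕ) : avgCost η ω W lam E x₀ π T =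
    (1 / (T : ℝ)) * expect (law η x₀ π T) (fun p => totalCost ω W lam p.1) - lam * E := rfl

/-- Cost of scheduling on a given channel state. -/
def schedCost (ω : Fin Q → ℝ) (W lam : ℝ) (q : Fin Q) : ℝ := W + lam * ω q

theorem cost_true (s : State Q) :
    costX W s true + lam * costQ ω s true = s.1 + schedCost ω W lam s.2 := by
  simp [costX, costQ, schedCost]; ring

theorem cost_false (s : State Q) :
    costX W s false + lam * costQ ω s false = s.1 := by
  simp [costX, costQ]

/-- A potential bounded above gives a lower bound for the average cost. -/
theorem exists_le_avgCost (h : State Q → ℝ) (G B : ℝ) (hx : 1 ≤ x₀) (hB : ∀ s, h s ≤ B)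
    (hk : ∀ l s u, 1 ≤ s.1 → π l s u ≠ 0 →
      G + h s ≤ costX W s u + lam * costQ ω s u + expect η fun q => h (nextAge s.1 u, q)) :
    ∃ C : ℝ, ∀ T : ℕ, 1 ≤ T → G - lam * E + C / T ≤ avgCost η ω W lam E x₀ π T := by
  refine ⟨expect η (fun q => h (x₀, q)) - B, fun T hT => ?_⟩
  have h1 := le_expect_total (fun s u => costX W s u + lam * costQ ω s u) h G hx hk T
  rw [expect_add (finite_support_law T)] at h1
  have h2 : expect (law η x₀ π T) (fun p => h p.2) ≤ B := by
    rw [← expect_const (law η x₀ π T) B]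
    exact expect_mono (finite_support_law T) fun p _ => hB _
  have hT' : (0 : ℝ) < T := by exact_mod_cast hT
  rw [avgCost_eq]
  have h3 : T * G + (expect η (fun q => h (x₀, q)) - B) ≤
      expect (law η x₀ π T) (fun p => totalCost ω W lam p.1) := by
    unfold totalCost; linarith
  have h4 := mul_le_mul_of_nonneg_left h3 (one_div_pos.2 hT').le
  have h5 : 1 / (T : ℝ) * (T * G + (expect η (fun q => h (x₀, q)) - B)) =
      G + (expect η (fun q => h (x₀, q)) - B) / T := by field_simp
  linarith

/-- A potential bounded below gives an upper bound for the average cost. -/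
theorem exists_avgCost_le (h : State Q → ℝ) (G B : ℝ) (hx : 1 ≤ x₀) (hB : ∀ s, B ≤ h s)
    (hk : ∀ l s u, 1 ≤ s.1 → π l s u ≠ 0 →
      costX W s u + lam * costQ ω s u + expect η (fun q => h (nextAge s.1 u, q)) ≤ G + h s) :
    ∃ C : ℝ, ∀ T : ℕ, 1 ≤ T → avgCost η ω W lam E x₀ π T ≤ G - lam * E + C / T := by
  refine ⟨expect η (fun q => h (x₀, q)) - B, fun T hT => ?_⟩
  have h1 := le_expect_total (η := η) (x₀ := x₀) (π := π)
    (fun s u => -(costX W s u + lam * costQ ω s u)) (fun s => -h s) (-G) hx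
    (fun l s u hs hu => by
      have := hk l s u hs hu
      rw [expect_neg]; linarith) T
  rw [expect_add (finite_support_law T), expect_neg, expect_neg] at h1
  have h2 : B ≤ expect (law η x₀ π T) (fun p => h p.2) := by
    rw [← expect_const (law η x₀ π T) B]
    exact expect_mono (finite_support_law T) fun p _ => hB _
  have hT' : (0 : ℝ) < T := by exact_mod_cast hT
  rw [avgCost_eq]
  have e : (fun p : History Q × State Q => (List.map
      (fun e : State Q × Bool => -(costX W e.1 e.2 + lam * costQ ω e.1 e.2)) p.1).sum) =
      fun p => - totalCost ω W lam p.1 := by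
    ext p
    unfold totalCost
    induction p.1 with
    | nil => simp
    | cons a l ih => simp only [List.map_cons, List.sum_cons, ih]; ring
  rw [e, expect_neg] at h1
  have h3 : expect (law η x₀ π T) (fun p => totalCost ω W lam p.1) ≤
      T * G + (expect η (fun q => h (x₀, q)) - B) := by
    linarith
  have h4 := mul_le_mul_of_nonneg_left h3 (one_div_pos.2 hT').le
  have h5 : 1 / (T : ℝ) * (T * G + (expect η (fun q => h (x₀, q)) - B)) =
      G + (expect η (fun q => h (x₀, q)) - B) / T := by field_simp
  linarith

/-- A bounded function `φ` of the age that satisfies the optimality inequality, restricted to the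
decisions that the policy can take, gives a lower bound for the average cost. -/
theorem exists_le_avgCost_of_age (φ : ℕ → ℝ) (m : ℕ → Fin Q → ℝ) (G B : ℝ) (hx : 1 ≤ x₀)
    (hφ : ∀ x, |φ x| ≤ B) (hm : ∀ x q, |m x q| ≤ B)
    (hle : ∀ l x q u, 1 ≤ x → π l (x, q) u ≠ 0 →
      m x q ≤ (if u then schedCost ω W lam q else 0) + φ (nextAge x u))
    (hsub : ∀ x, 1 ≤ x → G + φ x ≤ x + expect η (m x)) :
    ∃ C : ℝ, ∀ T : ℕ, 1 ≤ T → G - lam * E + C / T ≤ avgCost η ω W lam E x₀ π T := by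
  have hmB : ∀ x, |expect η (m x)| ≤ B := fun x => by
    rw [abs_le]
    constructor
    · rw [← expect_const η (-B)]
      exact expect_mono (Set.toFinite _) fun q _ => (abs_le.1 (hm x q)).1
    · rw [← expect_const η B]
      exact expect_mono (Set.toFinite _) fun q _ => (abs_le.1 (hm x q)).2
  have hH : ∀ x, expect η (fun q => (φ x - expect η (m x)) + m x q) = φ x := fun x => by
    rw [expect_const_add (Set.toFinite _)]
    ring
  -- The decision is made after `q` is seen, so the potential must depend on `q`; it is centred so
  -- that its mean over `q` is `φ x`.
  refine exists_le_avgCost (fun s => (φ s.1 - expect η (m s.1)) + m s.1 s.2) G (3 * B) hx ?_ ?_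
  · intro s
    have h1 := (abs_le.1 (hφ s.1)).2
    have h2 := (abs_le.1 (hmB s.1)).1
    have h3 := (abs_le.1 (hm s.1 s.2)).2
    linarith
  · rintro l ⟨x, q⟩ u hs hu
    have h1 := hle l x q u hs hu
    have h2 := hsub x hs
    simp only [hH]
    cases u
    · rw [cost_false]
      simp only [Bool.false_eq_true, if_false] at h1
      linarith
    · rw [cost_true]
      simp only [if_true] at h1
      linarith

theorem tendsto_const_add_div (G C : ℝ) :
    Tendsto (fun T : ℕ => G + C / (T : ℝ)) atTop (𝓝 G) := by
  simpa using (tendsto_const_div_atTop_nhds_zero_nat C).const_add G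

theorem le_liminf_of_le_add_div {G C : ℝ} {f : ℕ → ℝ} (h : ∀ T : ℕ, 1 ≤ T → G + C / T ≤ f T) :
    (G : EReal) ≤ liminf (fun T : ℕ => ((f T : ℝ) : EReal)) atTop := by
  have h1 : Tendsto (fun T : ℕ => (((G + C / (T : ℝ) : ℝ)) : EReal)) atTop (𝓝 (G : EReal)) :=
    (continuous_coe_real_ereal.tendsto G).comp (tendsto_const_add_div G C)
  rw [← h1.liminf_eq]
  refine liminf_le_liminf ?_
  filter_upwards [eventually_ge_atTop 1] with T hT
  exact_mod_cast h T hT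

end Average

/-! ### Solving the optimality equation. -/

section Value

variable {Q : ℕ} (η : PMF (Fin Q)) (c : Fin Q → ℝ)

/-- Value of the age after `n` further slots in which idling is allowed, relative to the average
cost `g`, when scheduling on channel state `q` costs `c q` and ends the cycle. -/
def cycleValue (g : ℝ) : ℕ → ℕ → ℝ
  | 0, x => x - g + expect η c
  | n + 1, x => x - g + expect η fun q => min (c q) (cycleValue g n (x + 1))

theorem expect_min_mono {y z : ℝ} (h : y ≤ z) :
    (expect η fun q => min (c q) y) ≤ expect η fun q => min (c q) z :=
  expect_mono (Set.toFinite _) fun _ _ => min_le_min_left _ h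

theorem cycleValue_add_one_le (g : ℝ) (n x : ℕ) :
    cycleValue η c g n x + 1 ≤ cycleValue η c g n (x + 1) := by
  induction n generalizing x with
  | zero => simp only [cycleValue]; push_cast; linarith
  | succ n ih =>
    simp only [cycleValue]
    have := expect_min_mono η c (show cycleValue η c g n (x + 1) ≤ cycleValue η c g n (x + 1 + 1)
      by linarith [ih (x + 1)])
    push_cast
    linarith

theorem continuous_cycleValue (n x : ℕ) : Continuous fun g => cycleValue η c g n x := by
  induction n generalizing x with
  | zero => simp only [cycleValue]; fun_prop
  | succ n ih =>
    have := ih (x + 1)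
    simp only [cycleValue, expect_fintype]
    fun_prop

theorem cycleValue_le (g : ℝ) (n x : ℕ) : cycleValue η c g n x ≤ x - g + expect η c := by
  cases n with
  | zero => exact le_rfl
  | succ n =>
    have : (expect η fun q => min (c q) (cycleValue η c g n (x + 1))) ≤ expect η c :=
      expect_mono (Set.toFinite _) fun q _ => min_le_left _ _
    simp only [cycleValue]
    linarith

/-- For `g ≤ 0` every slot contributes `x - g ≥ 0`, and the cycle ends with a charge of at least
`b`. This supplies the nonnegative endpoint when `g` is chosen by the intermediate value theorem. -/
theorem le_cycleValue {g b : ℝ} (hb : ∀ q, b ≤ c q) (hg : g ≤ 0) (n x : ℕ) :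
    b - g ≤ cycleValue η c g n x := by
  induction n generalizing x with
  | zero =>
    have : b ≤ expect η c := by
      rw [← expect_const η b]; exact expect_mono (Set.toFinite _) fun q _ => hb q
    have : (0 : ℝ) ≤ x := x.cast_nonneg
    simp only [cycleValue]; linarith
  | succ n ih =>
    have : b ≤ expect η fun q => min (c q) (cycleValue η c g n (x + 1)) := by
      rw [← expect_const η b]
      exact expect_mono (Set.toFinite _) fun q _ => le_min (hb q) (by linarith [ih (x + 1)])
    have : (0 : ℝ) ≤ x := x.cast_nonneg
    simp only [cycleValue]; linarith

/-- Forcing a schedule at a late enough age is harmless: idling there would already cost at least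
`N`, hence at least every `c q`. So the finite recursion is stationary and yields a fixed point. -/
theorem cycleValue_succ {g : ℝ} {N : ℕ} (hg : g ≤ 1 + expect η c) (hN : ∀ q, c q ≤ N) (n x : ℕ)
    (hx : N ≤ x + n) : cycleValue η c g (n + 1) x = cycleValue η c g n x := by
  induction n generalizing x with
  | zero =>
    simp only [cycleValue]
    congr 2
    ext q
    refine min_eq_left ((hN q).trans ?_)
    have : (N : ℝ) ≤ x := by exact_mod_cast hx
    push_cast
    linarith
  | succ n ih =>
    have := ih (x + 1) (by omega)
    rw [cycleValue, this, cycleValue]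

/-- The average cost optimality equation, normalized at age `1`, has a solution. -/
theorem exists_relativeValue : ∃ (g : ℝ) (V : ℕ → ℝ), V 1 = 0 ∧ (∀ x, V x + 1 ≤ V (x + 1)) ∧
    ∀ x, g + V x = x + expect η fun q => min (c q) (V (x + 1)) := by
  obtain ⟨K, hK⟩ := (Set.finite_range c).bddAbove
  obtain ⟨b, hb⟩ := (Set.finite_range c).bddBelow
  have hb' : ∀ q, b ≤ c q := fun q => hb ⟨q, rfl⟩
  obtain ⟨N, hN⟩ := exists_nat_ge K
  have hN' : ∀ q, c q ≤ N := fun q => (hK ⟨q, rfl⟩).trans hN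
  -- `g` is tuned so that a cycle starting at age `1` has relative cost zero.
  obtain ⟨g, hg⟩ : ∃ g, cycleValue η c g N 1 = 0 := by
    have h1 : cycleValue η c (1 + expect η c) N 1 ≤ 0 := by
      have := cycleValue_le η c (1 + expect η c) N 1
      push_cast at this; linarith
    have h2 : 0 ≤ cycleValue η c (min b 0) N 1 := by
      have := le_cycleValue η c hb' (min_le_right b 0) N 1
      linarith [min_le_left b 0]
    exact mem_range_of_exists_le_of_exists_ge (continuous_cycleValue η c N 1) ⟨_, h1⟩ ⟨_, h2⟩
  have hg' : g ≤ 1 + expect η c := by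
    have := cycleValue_le η c g N 1
    push_cast at this; linarith
  refine ⟨g, cycleValue η c g N, hg, cycleValue_add_one_le η c g N, fun x => ?_⟩
  have := cycleValue_succ η c hg' hN' N x (by omega)
  rw [← this, cycleValue]
  ring

end Value

/-! ### A bounded function with positive drift away from one age. -/

section Drift

variable {Q : ℕ} (η : PMF (Fin Q)) (a : ℕ → Fin Q → Bool)

/-- If age `y` is reached from age `1`, a bounded function of the age has drift at least `1`, except
at `y` and at large ages. -/
theorem exists_drift {y : ℕ} (M : ℕ) (hy1 : 1 ≤ y)
    (hr : ∀ x, 1 ≤ x → x < y → ∃ q, η q ≠ 0 ∧ a x q = false) :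
    ∃ (ψ : ℕ → ℝ) (B : ℝ), (∀ x, |ψ x| ≤ B) ∧ ∀ x, 1 ≤ x → x ≠ y → x < M →
      ψ x + 1 ≤ expect η fun q => ψ (nextAge x (a x q)) := by
  set r : ℕ → ℝ := fun x => expect η fun q => if a x q then 0 else 1 with hrdef
  have hr0 : ∀ x, 1 ≤ x → x < y → 0 < r x := by
    intro x h1 h2
    obtain ⟨q, hq, haq⟩ := hr x h1 h2
    simp only [hrdef, expect_fintype]
    refine Finset.sum_pos' (fun i _ => mul_nonneg ENNReal.toReal_nonneg (by split_ifs <;> norm_num))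
      ⟨q, Finset.mem_univ _, ?_⟩
    simpa [haq] using ENNReal.toReal_pos hq (η.apply_ne_top q)
  -- Solves `ψ (x + 1) * r x = ψ x + 1` with `ψ 1 = 0`, under the shift `ψ x = ζ (x - 1)`: drift
  -- exactly one below `y`, where the idling probability `r` is positive.
  let ζ : ℕ → ℝ := fun n => Nat.rec 0 (fun k z => (z + 1) / r (k + 1)) n
  have hζ0 : ζ 0 = 0 := rfl
  have hζ : ∀ k, ζ (k + 1) = (ζ k + 1) / r (k + 1) := fun _ => rfl
  have hr1 : ∀ x, r x ≤ 1 := by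
    intro x
    rw [← expect_const η 1]
    exact expect_mono (Set.toFinite _) fun q _ => by split_ifs <;> norm_num
  -- Between `y` and `M` idling gains exactly one, and scheduling jumps from a negative value to `ψ
  -- 1 = 0`, gaining at least one.
  obtain ⟨ψ, hψ⟩ : ∃ ψ : ℕ → ℝ, ∀ x, ψ x = if x ≤ y then ζ (x - 1) else min ((x : ℝ) - M) 0 :=
    ⟨_, fun _ => rfl⟩
  have hform : ∀ x, (expect η fun q => ψ (nextAge x (a x q))) = ψ (x + 1) * r x := by
    intro x
    rw [hrdef, ← expect_mul_left]
    congr 1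
    ext q
    cases a x q <;> simp [nextAge, hψ 1, hζ0, hy1]
  refine ⟨ψ, M + ∑ k ∈ Finset.range (y + 1), |ζ k|, fun x => ?_, fun x h1 hy hM => ?_⟩
  · have hs : 0 ≤ ∑ k ∈ Finset.range (y + 1), |ζ k| := Finset.sum_nonneg fun _ _ => abs_nonneg _
    have hM0 : (0 : ℝ) ≤ M := M.cast_nonneg
    have hx0 : (0 : ℝ) ≤ x := x.cast_nonneg
    rw [hψ]
    split_ifs with h
    · have : |ζ (x - 1)| ≤ _ := Finset.single_le_sum (f := fun k => |ζ k|)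
        (fun _ _ => abs_nonneg _) (Finset.mem_range.2 (show x - 1 < y + 1 by omega))
      linarith
    · rw [abs_le]
      exact ⟨le_min (by linarith) (by linarith), (min_le_right _ _).trans (by linarith)⟩
  · rw [hform]
    by_cases hxy : x < y
    · have := hr0 x h1 hxy
      obtain ⟨k, rfl⟩ : ∃ k, x = k + 1 := ⟨x - 1, by omega⟩
      rw [hψ, hψ, if_pos (by omega), if_pos (by omega)]
      simp only [Nat.add_sub_cancel, hζ]
      rw [div_mul_cancel₀ _ this.ne']
    · have hM' : (x : ℝ) + 1 ≤ M := by exact_mod_cast hM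
      rw [hψ, hψ, if_neg (by omega), if_neg (by omega)]
      push_cast
      rw [min_eq_left (by linarith), min_eq_left (by linarith)]
      nlinarith [hr1 x]

end Drift

/-! ### Verification of the greedy rule and strict loss of suboptimal policies. -/

section Optimality

variable {Q : ℕ} {η : PMF (Fin Q)} {ω : Fin Q → ℝ} {W lam E : ℝ} {x₀ : ℕ}

/-- A solution of the average cost optimality equation, normalized at age `1`. -/
structure IsRelativeValue (η : PMF (Fin Q)) (c : Fin Q → ℝ) (g : ℝ) (V : ℕ → ℝ) : Prop where
  one : V 1 = 0
  add_one_le : ∀ x, V x + 1 ≤ V (x + 1)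
  eq : ∀ x, g + V x = x + expect η fun q => min (c q) (V (x + 1))

variable {g : ℝ} {V : ℕ → ℝ} {c : Fin Q → ℝ}

theorem IsRelativeValue.strictMono (hV : IsRelativeValue η c g V) : StrictMono V :=
  strictMono_nat_of_lt_succ fun x => by linarith [hV.add_one_le x]

theorem IsRelativeValue.exists_le (hV : IsRelativeValue η c g V) (K : ℝ) :
    ∃ M, ∀ x, M ≤ x → K ≤ V x := by
  have h : ∀ n : ℕ, (n : ℝ) + V 0 ≤ V n := by
    intro n
    induction n with
    | zero => simp
    | succ n ih => push_cast; linarith [hV.add_one_le n]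
  obtain ⟨M, hM⟩ := exists_nat_ge (K - V 0)
  refine ⟨M, fun x hx => ?_⟩
  have : (M : ℝ) ≤ x := by exact_mod_cast hx
  linarith [h x]

theorem eq_of_stationary_ne_zero {a : ℕ → Fin Q → Bool} {l : History Q} {x : ℕ} {q : Fin Q}
    {u : Bool} (h : stationary a l (x, q) u ≠ 0) : u = a x q := by
  rw [← PMF.mem_support_iff, stationary, PMF.support_pure] at h
  exact h

theorem min_min_eq {K : ℝ} (hc : ∀ q, c q ≤ K) (y : ℝ) (q : Fin Q) :
    min (c q) (min y K) = min (c q) y := by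
  rw [min_comm y K, ← min_assoc, min_eq_left (hc q)]

/-- The optimal average cost bounds the average cost of every policy, up to `O(1 / T)`. -/
theorem IsRelativeValue.exists_le_avgCost (hV : IsRelativeValue η (schedCost ω W lam) g V)
    (hx : 1 ≤ x₀) (π : Policy Q) : ∃ C : ℝ, ∀ T : ℕ, 1 ≤ T →
      g - lam * E + C / T ≤ avgCost η ω W lam E x₀ π T := by
  obtain ⟨K, hK⟩ := (Set.finite_range (schedCost ω W lam)).bddAbove
  obtain ⟨b, hb⟩ := (Set.finite_range (schedCost ω W lam)).bddBelow
  have hc : ∀ q, schedCost ω W lam q ≤ max K 0 := fun q => (hK ⟨q, rfl⟩).trans (le_max_left _ _)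
  have hb' : ∀ q, b ≤ schedCost ω W lam q := fun q => hb ⟨q, rfl⟩
  have hV0 : ∀ x, V 0 ≤ V x := fun x => hV.strictMono.monotone x.zero_le
  have hK0 := le_max_right K 0
  have habs := abs_nonneg b
  have habs' := abs_nonneg (V 0)
  have hφ : ∀ x, -(|b| + |V 0|) ≤ min (V x) (max K 0) := fun x =>
    le_min (by linarith [hV0 x, neg_abs_le (V 0)]) (by linarith)
  -- Truncating at `max K 0` rather than `K` preserves the value `0` at age `1`.
  refine exists_le_avgCost_of_age (fun x => min (V x) (max K 0))
    (fun x q => min (schedCost ω W lam q) (min (V (x + 1)) (max K 0))) g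
    (max K 0 + |b| + |V 0|) hx ?_ ?_ ?_ ?_
  · intro x
    rw [abs_le]
    exact ⟨by linarith [hφ x], by linarith [min_le_right (V x) (max K 0)]⟩
  · intro x q
    rw [abs_le]
    constructor
    · exact (by linarith : _ ≤ -(|b| + |V 0|)).trans
        (le_min (by linarith [hb' q, neg_abs_le b]) (hφ _))
    · linarith [min_le_left (schedCost ω W lam q) (min (V (x + 1)) (max K 0)), hc q]
  · intro l x q u h1 hu
    cases u
    · simpa [nextAge] using min_le_right _ (min (V (x + 1)) (max K 0))
    · simp [nextAge, hV.one]
  · intro x h1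
    simp only [min_min_eq hc]
    rw [← hV.eq x]
    linarith [min_le_left (V x) (max K 0)]

/-- Scheduling exactly when it costs no more than idling in the optimality equation. -/
def greedy (c : Fin Q → ℝ) (V : ℕ → ℝ) (x : ℕ) (q : Fin Q) : Bool := decide (c q ≤ V (x + 1))

theorem IsRelativeValue.exists_avgCost_greedy_le
    (hV : IsRelativeValue η (schedCost ω W lam) g V) (hx : 1 ≤ x₀) : ∃ C : ℝ, ∀ T : ℕ, 1 ≤ T →
      avgCost η ω W lam E x₀ (stationary (greedy (schedCost ω W lam) V)) T ≤
        g - lam * E + C / T := by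
  obtain ⟨b, hb⟩ := (Set.finite_range (schedCost ω W lam)).bddBelow
  have hb' : ∀ q, b ≤ schedCost ω W lam q := fun q => hb ⟨q, rfl⟩
  have hH : ∀ x : ℕ, expect η (fun q => ((x : ℝ) - g) + min (schedCost ω W lam q) (V (x + 1))) =
      V x := fun x => by
    rw [expect_const_add (Set.toFinite _)]
    linarith [hV.eq x]
  refine exists_avgCost_le
    (fun s => ((s.1 : ℝ) - g) + min (schedCost ω W lam s.2) (V (s.1 + 1))) g
    (min b (V 0) - g) hx ?_ ?_
  · intro s
    have h1 : min b (V 0) ≤ min (schedCost ω W lam s.2) (V (s.1 + 1)) :=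
      min_le_min (hb' _) (hV.strictMono.monotone (Nat.zero_le _))
    have h2 : (0 : ℝ) ≤ s.1 := s.1.cast_nonneg
    linarith
  · rintro l ⟨x, q⟩ u hs hu
    have hu' := eq_of_stationary_ne_zero hu
    simp only [hH]
    by_cases h : schedCost ω W lam q ≤ V (x + 1)
    · obtain rfl : u = true := by simp [hu', greedy, h]
      rw [cost_true, nextAge_true, hV.one, min_eq_left h]
      linarith
    · obtain rfl : u = false := by simpa [greedy, h] using hu'
      rw [cost_false, nextAge_false, min_eq_right (not_le.1 h).le]
      linarith

theorem IsRelativeValue.tendsto_avgCost_greedy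
    (hV : IsRelativeValue η (schedCost ω W lam) g V) (hx : 1 ≤ x₀) :
    Tendsto (avgCost η ω W lam E x₀ (stationary (greedy (schedCost ω W lam) V))) atTop
      (𝓝 (g - lam * E)) := by
  obtain ⟨C, hC⟩ := hV.exists_avgCost_greedy_le (E := E) hx
  obtain ⟨C', hC'⟩ := hV.exists_le_avgCost (E := E) hx (stationary (greedy (schedCost ω W lam) V))
  refine tendsto_of_tendsto_of_tendsto_of_le_of_le' (tendsto_const_add_div _ C')
    (tendsto_const_add_div _ C) ?_ ?_
  · filter_upwards [eventually_ge_atTop 1] with T hT using hC' T hT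
  · filter_upwards [eventually_ge_atTop 1] with T hT using hC T hT

theorem IsRelativeValue.isOptimal_greedy
    (hV : IsRelativeValue η (schedCost ω W lam) g V) (hx : 1 ≤ x₀) :
    IsOptimal η ω W lam E x₀ (stationary (greedy (schedCost ω W lam) V)) := by
  refine ⟨g - lam * E, hV.tendsto_avgCost_greedy hx, fun π => ?_⟩
  obtain ⟨C, hC⟩ := hV.exists_le_avgCost (E := E) hx π
  exact le_liminf_of_le_add_div hC

/-- Scheduling resets the age to `1`, so an age can be reached from `1` only by idling at every
smaller age. -/
theorem Visits.spec {a : ℕ → Fin Q → Bool} {s : State Q} (h : Visits η 1 (stationary a) s) :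
    η s.2 ≠ 0 ∧ 1 ≤ s.1 ∧ ∀ x, 1 ≤ x → x < s.1 → ∃ q, η q ≠ 0 ∧ a x q = false := by
  obtain ⟨t, l, h⟩ := h
  induction t generalizing l s with
  | zero =>
    obtain ⟨q, hq, e⟩ := law_zero_ne_zero h
    obtain ⟨rfl, rfl⟩ := Prod.mk.inj e
    exact ⟨hq, le_rfl, fun x h1 h2 => absurd h2 (not_lt.2 h1)⟩
  | succ t ih =>
    obtain ⟨⟨l', x', q'⟩, u, q, h1, h2, hq, e⟩ := law_succ_ne_zero h
    obtain ⟨rfl, rfl⟩ := Prod.mk.inj e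
    obtain ⟨hq', hx', hr⟩ := ih _ h1
    have hu := eq_of_stationary_ne_zero h2
    cases u
    · refine ⟨hq, by simp [nextAge], fun x h3 h4 => ?_⟩
      rcases (Nat.lt_succ_iff_lt_or_eq.1 h4) with h5 | rfl
      · exact hr x h3 h5
      · exact ⟨q', hq', hu.symm⟩
    · exact ⟨hq, le_rfl, fun x h3 h4 => absurd h4 (not_lt.2 h3)⟩

/-- A policy that takes a suboptimal decision in a visited state has a larger average cost. -/
theorem IsRelativeValue.exists_le_avgCost_of_loss
    (hV : IsRelativeValue η (schedCost ω W lam) g V) {a : ℕ → Fin Q → Bool} {y : ℕ} {p : Fin Q}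
    (hvis : Visits η 1 (stationary a) (y, p))
    (hloss : if a y p then V (y + 1) < schedCost ω W lam p
      else schedCost ω W lam p < V (y + 1)) :
    ∃ ε > 0, ∃ C : ℝ, ∀ T : ℕ, 1 ≤ T →
      g + ε - lam * E + C / T ≤ avgCost η ω W lam E 1 (stationary a) T := by
  set c := schedCost ω W lam with hcdef
  obtain ⟨hp, hy, hr⟩ := hvis.spec
  obtain ⟨K', hK'⟩ := (Set.finite_range c).bddAbove
  obtain ⟨b, hb⟩ := (Set.finite_range c).bddBelow
  -- The margin `1` keeps `c p < V (y + 1)` strict after truncation at `K`.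
  obtain ⟨K, hK1, hK0⟩ : ∃ K : ℝ, (∀ q, c q + 1 ≤ K) ∧ 0 ≤ K :=
    ⟨max (K' + 1) 0, fun q => le_max_of_le_left (by linarith [hK' ⟨q, rfl⟩]), le_max_right _ _⟩
  have hc : ∀ q, c q ≤ K := fun q => by linarith [hK1 q]
  have hb' : ∀ q, b ≤ c q := fun q => hb ⟨q, rfl⟩
  obtain ⟨M, hM⟩ := hV.exists_le (K + 1)
  obtain ⟨ψ, B, hB, hψ⟩ := exists_drift η a M hy hr
  have hB0 : 0 ≤ B := (abs_nonneg _).trans (hB 0)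
  set φ : ℕ → ℝ := fun x => min (V x) K with hφdef
  have hφ1 : φ 1 = 0 := by simp [hφdef, hV.one, hK0]
  have hφle : ∀ x, φ x ≤ K := fun x => min_le_right _ _
  have hφge : ∀ x, -|V 0| ≤ φ x := fun x => le_min
    (by linarith [hV.strictMono.monotone x.zero_le, neg_abs_le (V 0)])
    (by linarith [abs_nonneg (V 0)])
  -- The policy's own continuation cost replaces the minimum, so `loss` records what its decisions
  -- and the truncation give away.
  set m : ℕ → Fin Q → ℝ := fun x q => (if a x q then c q else 0) + φ (nextAge x (a x q)) with hmdef
  have hmle : ∀ x q, min (c q) (V (x + 1)) ≤ m x q := by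
    intro x q
    simp only [hmdef]
    rw [← min_min_eq hc]
    cases a x q
    · simp [nextAge, hφdef]
    · simp [nextAge, hφ1]
  have hmlt : min (c p) (V (y + 1)) < m y p := by
    simp only [hmdef]
    cases h : a y p
    · simp only [h, Bool.false_eq_true, if_false] at hloss
      rw [min_eq_left hloss.le]
      simpa [nextAge, hφdef] using ⟨hloss, by linarith [hK1 p]⟩
    · simp only [h, if_true] at hloss
      rw [min_eq_right hloss.le]
      simpa [nextAge, hφ1] using hloss
  set loss : ℕ → ℝ := fun x => x + expect η (m x) - g - φ x with hlossdef
  have hge : ∀ x, expect η (fun q => min (c q) (V (x + 1))) ≤ expect η (m x) := fun x =>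
    expect_mono (Set.toFinite _) fun q _ => hmle x q
  have hφV : ∀ x, φ x ≤ V x := fun x => min_le_left _ _
  have hloss0 : ∀ x, 0 ≤ loss x := fun x => by
    simp only [hlossdef]
    linarith [hge x, hφV x, hV.eq x]
  have hlossM : ∀ x, M ≤ x → 1 ≤ loss x := fun x hx => by
    simp only [hlossdef]
    linarith [hge x, hM x hx, hφle x, hV.eq x]
  have hlossy : 0 < loss y := by
    have h3 : expect η (fun q => min (c q) (V (y + 1))) < expect η (m y) := by
      rw [expect_fintype, expect_fintype]
      refine Finset.sum_lt_sum (fun q _ => mul_le_mul_of_nonneg_left (hmle y q)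
        ENNReal.toReal_nonneg) ⟨p, Finset.mem_univ _, ?_⟩
      exact mul_lt_mul_of_pos_left hmlt (ENNReal.toReal_pos hp (η.apply_ne_top p))
    simp only [hlossdef]
    linarith [hφV y, hV.eq y]
  -- The drift of `ψ` is at least `-2 * B` everywhere, so `ε * (1 + 2 * B)` is the slack needed at
  -- `y` and from `M` on; elsewhere drift one suffices.
  set ε := min (loss y) 1 / (1 + 2 * B) with hεdef
  have hε : 0 < ε := div_pos (lt_min hlossy one_pos) (by linarith)
  have hεB : ε * (1 + 2 * B) = min (loss y) 1 := div_mul_cancel₀ _ (by linarith)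
  have habs := abs_nonneg b
  have habs' := abs_nonneg (V 0)
  have hψε : ∀ x, |ε * ψ x| ≤ ε * B := fun x => by
    rw [abs_mul, abs_of_pos hε]
    exact mul_le_mul_of_nonneg_left (hB x) hε.le
  refine ⟨ε, hε, exists_le_avgCost_of_age (fun x => φ x + ε * ψ x)
    (fun x q => m x q + ε * ψ (nextAge x (a x q))) (g + ε)
    (2 * |V 0| + 2 * |b| + 2 * K + ε * B) le_rfl ?_ ?_ ?_ ?_⟩
  · intro x
    have h := abs_le.1 (hψε x)
    rw [abs_le]
    exact ⟨by linarith [hφge x], by linarith [hφle x]⟩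
  · intro x q
    have h := abs_le.1 (hψε (nextAge x (a x q)))
    have h1 := hφge (nextAge x (a x q))
    have h2 := hφle (nextAge x (a x q))
    have h3 : -|b| ≤ (if a x q then c q else 0) ∧ (if a x q then c q else 0) ≤ K := by
      split_ifs
      · exact ⟨by linarith [hb' q, neg_abs_le b], hc q⟩
      · exact ⟨by linarith, hK0⟩
    rw [abs_le]
    simp only [hmdef]
    exact ⟨by linarith [h3.1], by linarith [h3.2]⟩
  · intro l x q u h1 hu
    obtain rfl := eq_of_stationary_ne_zero hu
    simp only [hmdef]
    linarith
  · intro x h1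
    rw [expect_add (Set.toFinite _), expect_mul_left]
    have h2 : ε - loss x ≤ ε * ((expect η fun q => ψ (nextAge x (a x q))) - ψ x) := by
      have h3 : -(2 * B) ≤ (expect η fun q => ψ (nextAge x (a x q))) - ψ x := by
        have : -B ≤ expect η fun q => ψ (nextAge x (a x q)) := by
          rw [← expect_const η (-B)]
          exact expect_mono (Set.toFinite _) fun q _ => (abs_le.1 (hB _)).1
        linarith [(abs_le.1 (hB x)).2]
      have h4 := mul_le_mul_of_nonneg_left h3 hε.le
      by_cases hxy : x = y
      · subst hxy
        linarith [min_le_left (loss x) 1]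
      · by_cases hxM : x < M
        · have h5 := mul_le_mul_of_nonneg_left
            (show 1 ≤ (expect η fun q => ψ (nextAge x (a x q))) - ψ x by
              linarith [hψ x h1 hxy hxM]) hε.le
          linarith [hloss0 x]
        · linarith [hlossM x (not_lt.1 hxM), min_le_right (loss y) 1]
    simp only [hlossdef] at h2
    linarith

/-- In the states that it visits, an optimal stationary policy attains the minimum in the
optimality equation. -/
theorem IsRelativeValue.schedCost_le_or_ge_of_isOptimal
    (hV : IsRelativeValue η (schedCost ω W lam) g V) {a : ℕ → Fin Q → Bool}
    (ha : IsOptimal η ω W lam E 1 (stationary a)) {x : ℕ} {q : Fin Q}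
    (hvis : Visits η 1 (stationary a) (x, q)) :
    if a x q then schedCost ω W lam q ≤ V (x + 1) else V (x + 1) ≤ schedCost ω W lam q := by
  by_contra hcon
  obtain ⟨ε, hε, C, hC⟩ := hV.exists_le_avgCost_of_loss (E := E) hvis
    (by cases h : a x q <;> simpa [h] using hcon)
  obtain ⟨g', hg', hopt⟩ := ha
  have h1 : g + ε - lam * E ≤ g' := by
    refine le_of_tendsto_of_tendsto (tendsto_const_add_div _ C) hg' ?_
    filter_upwards [eventually_ge_atTop 1] with T hT using hC T hT
  have h2 : (g' : EReal) ≤ ((g - lam * E : ℝ) : EReal) := by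
    refine (hopt (stationary (greedy (schedCost ω W lam) V))).trans_eq ?_
    exact ((continuous_coe_real_ereal.tendsto _).comp
      (hV.tendsto_avgCost_greedy le_rfl)).liminf_eq
  have h3 := EReal.coe_le_coe_iff.1 h2
  linarith

end Optimality

end AoI

end

/-! ### Thresholds. -/

theorem lemma1 {Q : ℕ} (η : PMF (Fin Q)) (ω : Fin Q → ℝ) (hω : StrictMono ω)
    (W lam E : ℝ) (hW : 0 ≤ W) (hlam : 0 ≤ lam) :
    -- an optimal stationary deterministic policy of dual threshold form exists
    (∃ (a : ℕ → Fin Q → Bool) (τ : Fin Q → ℕ),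
      (∀ x₀ : ℕ, 1 ≤ x₀ → AoI.IsOptimal η ω W lam E x₀ (AoI.stationary a)) ∧
      (∀ (x : ℕ) (q : Fin Q), a x q = true ↔ τ q ≤ x) ∧
      Monotone τ) ∧
    -- every optimal stationary deterministic policy has this form on the states it visits
    (∀ a : ℕ → Fin Q → Bool, AoI.IsOptimal η ω W lam E 1 (AoI.stationary a) →
      ∃ τ : Fin Q → ℕ,
        (∀ (x : ℕ) (q : Fin Q), AoI.Visits η 1 (AoI.stationary a) (x, q) →
          (a x q = true ↔ τ q ≤ x)) ∧
        (0 < lam → Monotone τ)) := by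
  classical
  obtain ⟨g, V, h1, h2, h3⟩ := AoI.exists_relativeValue η (AoI.schedCost ω W lam)
  have hV : AoI.IsRelativeValue η (AoI.schedCost ω W lam) g V := ⟨h1, h2, h3⟩
  set c := AoI.schedCost ω W lam with hc
  have hcmono : Monotone c := fun q q' h => by
    have := mul_le_mul_of_nonneg_left (hω.monotone h) hlam
    simp only [hc, AoI.schedCost]; linarith
  have hmono : Monotone V := hV.strictMono.monotone
  have hex' : ∀ q, ∃ x, c q < V (x + 1) := fun q => by
    obtain ⟨M, hM⟩ := hV.exists_le (c q + 1)
    exact ⟨M, by linarith [hM (M + 1) (by omega)]⟩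
  have hex : ∀ q, ∃ x, c q ≤ V (x + 1) := fun q => (hex' q).imp fun _ h => h.le
  refine ⟨⟨AoI.greedy c V, fun q => Nat.find (hex q), fun x₀ hx => hV.isOptimal_greedy hx,
    fun x q => ?_, fun q q' h => ?_⟩, fun a ha => ?_⟩
  · dsimp only
    rw [AoI.greedy, decide_eq_true_iff]
    exact ⟨fun h => Nat.find_min' _ h, fun h => (Nat.find_spec (hex q)).trans
      (hmono (by omega))⟩
  · exact Nat.find_min' _ ((hcmono h).trans (Nat.find_spec (hex q')))
  -- The threshold is the first age where scheduling is strictly better, or the tie age if the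
  -- policy visits it and schedules there. Strict monotonicity of `V` leaves no second tie.
  · have hτ : ∀ q, ∃ x, c q < V (x + 1) ∨
        (c q = V (x + 1) ∧ AoI.Visits η 1 (AoI.stationary a) (x, q) ∧ a x q = true) :=
      fun q => (hex' q).imp fun x hx => Or.inl hx
    refine ⟨fun q => Nat.find (hτ q), fun x q hvis => ?_, fun hpos q q' h => ?_⟩
    · dsimp only
      have key := hV.schedCost_le_or_ge_of_isOptimal ha hvis
      constructor
      · intro hax
        rw [hax, if_pos rfl] at key
        refine Nat.find_min' _ ?_
        rcases key.lt_or_eq with h | h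
        · exact Or.inl h
        · exact Or.inr ⟨h, hvis, hax⟩
      · intro hle
        by_contra hax
        rw [if_neg hax] at key
        rcases Nat.find_spec (hτ q) with h | ⟨h, -, h'⟩
        · linarith [hmono (show Nat.find (hτ q) + 1 ≤ x + 1 by omega)]
        · rcases hle.lt_or_eq with hlt | heq
          · linarith [hV.strictMono (show Nat.find (hτ q) + 1 < x + 1 by omega)]
          · rw [heq] at h'
            exact hax h'
    -- For `lam > 0` the costs differ strictly, so a tie for `q'` is a strict preference for `q`,
    -- whatever the tie-breaking.
    · rcases h.lt_or_eq with hlt | rfl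
      · have hclt : c q < c q' := by
          have := mul_lt_mul_of_pos_left (hω hlt) hpos
          simp only [hc, AoI.schedCost]; linarith
        refine Nat.find_min' _ (Or.inl (hclt.trans_le ?_))
        rcases Nat.find_spec (hτ q') with h | ⟨h, -⟩
        · exact h.le
        · exact h.le
      · exact le_rfl
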